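/- For real $\lambda>0$ define the Gegenbauer polynomials by $C_0^{\lambda}(x)=1$, $C_1^{\lambda}(x)=2\lambda x$ and $$C_n^{\lambda}(x)=\frac{n+\lambda-1}{n}\,2x\,C_{n-1}^{\lambda}(x)-\frac{n+2\lambda-2}{n}\,C_{n-2}^{\lambda}(x)\qquad(n\ge 2).$$ A number $x\in(-1,1)$ is called $\lambda$-gegenbadly approximable if there is a constant $c_x>0$ such that $|C_n^{\lambda}(x)|\ge c_x\, n^{\lambda-1}$ for all integers $n\ge 1$. A real number $\alpha$ is called badly approximable if there is a constant $c_\alpha>0$ such that $|\alpha-p/q|\ge c_\alpha/q^2$ for all integers $p$ and all integers $q\ge 1$. **Theorem.** Let $\lambda$ be a positive odd integer. Then no $\lambda$-gegenbadly approximable numbers exist. Moreover, for every $x\in(-1,1)$ there exists a constant $c_x\ge 0$ (which may depend on $\lambda$) such that $$|C_n^{\lambda}(x)|\le c_x\, n^{\lambda-2}\qquad\text{for infinitely many integers } n\ge 1.$$ When $\lambda=1$ and $x\in(-1,1)$, there exists a constant $c_x>0$ such that $|C_n^{1}(x)|>c_x/n$ for all integers $n\ge 1$ if and only if $x=\cos\theta$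 for some real $\theta$ such that $\theta/\pi$ is badly approximable. -/

import Mathlib

/-- The value `C_n^lam(x)` of the Gegenbauer polynomial, by the three-term recurrence
`C_n = ((n + lam - 1) / n) * 2x * C_{n-1} - ((n + 2 lam - 2) / n) * C_{n-2}` for `n ≥ 2`. -/
noncomputable def gegenbauer (lam : ℝ) : ℕ → ℝ → ℝ
  | 0, _ => 1
  | 1, x => 2 * lam * x
  | n + 2, x =>
      (((n + 2 : ℕ) : ℝ) + lam - 1) / ((n + 2 : ℕ) : ℝ) * (2 * x) * gegenbauer lam (n + 1) x
        - (((n + 2 : ℕ) : ℝ) + 2 * lam - 2) / ((n + 2 : ℕ) : ℝ) * gegenbauer lam n x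

/-- `x ∈ (-1, 1)` is gegenbadly approximable with respect to `lam`: there is `c > 0` with
`|C_n^lam(x)| ≥ c * n ^ (lam - 1)` for all positive integers `n`. -/
def IsGegenbadlyApproximable (lam x : ℝ) : Prop :=
  x ∈ Set.Ioo (-1 : ℝ) 1 ∧
    ∃ c : ℝ, 0 < c ∧ ∀ n : ℕ, 1 ≤ n → c * (n : ℝ) ^ (lam - 1) ≤ |gegenbauer lam n x|

/-- `α` is badly approximable: there is `c > 0` with `|α - p / q| ≥ c / q ^ 2` for all
integers `p` and all positive integers `q`. -/
def IsBadlyApproximable (α : ℝ) : Prop :=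
  ∃ c : ℝ, 0 < c ∧ ∀ (p : ℤ) (q : ℕ), 1 ≤ q → c / (q : ℝ) ^ 2 ≤ |α - (p : ℝ) / (q : ℝ)|

open Filter Asymptotics

/-- The recurrence of the Gegenbauer polynomials with denominators cleared. -/
theorem gegenbauer_recurrence (lam : ℝ) (n : ℕ) (x : ℝ) :
    ((n : ℝ) + 2) * gegenbauer lam (n + 2) x =
      (n + 1 + lam) * (2 * x) * gegenbauer lam (n + 1) x
        - (n + 2 * lam) * gegenbauer lam n x := by
  have h : (n : ℝ) + 2 ≠ 0 := by positivity
  rw [gegenbauer]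
  push_cast
  field_simp
  ring

/-- The relation raising the parameter of the Gegenbauer polynomials by one. -/
theorem gegenbauer_add_one (lam : ℝ) (x : ℝ) (n : ℕ) :
    2 * lam * (1 - x ^ 2) * gegenbauer (lam + 1) n x =
      (n + 2 * lam) * gegenbauer lam n x - (n + 1) * x * gegenbauer lam (n + 1) x := by
  induction n using Nat.twoStepInduction with
  | zero => simp [gegenbauer]; ring
  | one =>
    have h := gegenbauer_recurrence lam 0 x
    simp only [gegenbauer] at h ⊢
    push_cast at h ⊢
    field_simp
    ring
  | more n h0 h1 =>
    have hn : (n : ℝ) + 2 ≠ 0 := by positivity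
    have r := gegenbauer_recurrence (lam + 1) n x
    have r0 := gegenbauer_recurrence lam n x
    have r1 := gegenbauer_recurrence lam (n + 1) x
    push_cast at h0 h1 r1 ⊢
    apply mul_left_cancel₀ hn
    linear_combination (2 * lam * (1 - x ^ 2)) * r + (n + 2 + lam) * (2 * x) * h1
      - (n + 2 * lam + 2) * h0 + (-(n + 2 + 2 * lam)) * r0 + (n + 2) * x * r1

theorem sin_mul_gegenbauer_one (θ : ℝ) (n : ℕ) :
    Real.sin θ * gegenbauer 1 n (Real.cos θ) = Real.sin ((n + 1) * θ) := by
  induction n using Nat.twoStepInduction with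
  | zero => simp [gegenbauer]
  | one =>
    simp only [gegenbauer]
    rw [show ((1 : ℕ) + 1 : ℝ) * θ = 2 * θ by push_cast; ring, Real.sin_two_mul]
    ring
  | more n h0 h1 =>
    have hn : (n : ℝ) + 2 ≠ 0 := by positivity
    have r := gegenbauer_recurrence 1 n (Real.cos θ)
    have e0 : ((n : ℝ) + 1) * θ = ((n + 2 : ℝ) * θ) - θ := by ring
    have e2 : (((n + 2 : ℕ) : ℝ) + 1) * θ = ((n + 2 : ℝ) * θ) + θ := by push_cast; ring
    have e1 : (((n + 1 : ℕ) : ℝ) + 1) * θ = (n + 2 : ℝ) * θ := by push_cast; ring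
    rw [e0, Real.sin_sub] at h0
    rw [e1] at h1
    rw [e2, Real.sin_add]
    apply mul_left_cancel₀ hn
    linear_combination Real.sin θ * r + (n + 2) * (2 * Real.cos θ) * h1 - (n + 2) * h0

theorem natCast_add_one_isBigO : (fun n : ℕ => (n : ℝ) + 1) =O[atTop] fun n : ℕ => (n : ℝ) := by
  refine IsBigO.of_bound 2 ?_
  filter_upwards [eventually_ge_atTop 1] with n hn
  have : (1 : ℝ) ≤ n := by exact_mod_cast hn
  rw [Real.norm_of_nonneg (by positivity), Real.norm_of_nonneg (by positivity)]
  linarith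

theorem succ_pow_sub_pow_isBigO (m : ℕ) :
    (fun n : ℕ => ((n : ℝ) + 1) ^ (m + 1) - (n : ℝ) ^ (m + 1)) =O[atTop]
      fun n : ℕ => (n : ℝ) ^ m := by
  induction m with
  | zero => simpa using isBigO_refl (fun _ : ℕ => (1 : ℝ)) atTop
  | succ m ih =>
    have h := (ih.mul natCast_add_one_isBigO).add
      (isBigO_refl (fun n : ℕ => (n : ℝ) ^ (m + 1)) atTop)
    exact h.congr_left fun n => by ring

/-- The first-order asymptotics of the Gegenbauer polynomials with positive integer parameter at a
point of the open interval `(-1, 1)`. -/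
theorem gegenbauer_asymptotics {θ : ℝ} (hθ : Real.sin θ ≠ 0) (m : ℕ) :
    ∃ K : ℝ, (fun n : ℕ => (n : ℝ) * (gegenbauer ((m : ℝ) + 1) n (Real.cos θ)
      - K * (n : ℝ) ^ m * Real.cos ((n + m + 1) * θ - (m + 1) * (Real.pi / 2))))
        =O[atTop] fun n : ℕ => (n : ℝ) ^ m := by
  induction m with
  | zero =>
    refine ⟨(Real.sin θ)⁻¹, ?_⟩
    refine (isBigO_zero _ _).congr_left fun n => ?_
    have h := sin_mul_gegenbauer_one θ n
    simp only [Nat.cast_zero, zero_add, add_zero, one_mul, pow_zero, mul_one,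
      Real.cos_sub_pi_div_two, ← h]
    field_simp
    simp
  | succ m ih =>
    obtain ⟨K, hK⟩ := ih
    set C : ℕ → ℝ := fun n => gegenbauer ((m : ℝ) + 1) n (Real.cos θ) with hC
    set φ : ℕ → ℝ := fun n => (n + m + 1) * θ - (m + 1) * (Real.pi / 2) with hφ
    have hE : (fun n : ℕ => (n : ℝ) * (C n - K * (n : ℝ) ^ m * Real.cos (φ n))) =O[atTop]
      fun n : ℕ => (n : ℝ) ^ m := hK
    have hid : (fun n : ℕ => (n : ℝ)) =O[atTop] fun n : ℕ => (n : ℝ) := isBigO_refl _ _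
    have hcos (f : ℕ → ℝ) : (fun n => Real.cos (f n)) =O[atTop] fun _ : ℕ => (1 : ℝ) :=
      IsBigO.of_bound 1 (Eventually.of_forall fun n => by simpa using Real.abs_cos_le_one _)
    have hE' : (fun n : ℕ => ((n : ℝ) + 1) *
        (C (n + 1) - K * ((n : ℝ) + 1) ^ m * Real.cos (φ (n + 1)))) =O[atTop]
        fun n : ℕ => (n : ℝ) ^ m := by
      have h := hE.comp_tendsto (tendsto_add_atTop_nat 1)
      refine (h.congr_left fun n => ?_).trans ((natCast_add_one_isBigO.pow m).congr_left fun n => ?_)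
      · simp
      · simp
    have hP : (fun n : ℕ => (n : ℝ) ^ (m + 1) * Real.cos (φ n)) =O[atTop]
        fun n : ℕ => (n : ℝ) ^ (m + 1) := by
      simpa using (isBigO_refl (fun n : ℕ => (n : ℝ) ^ (m + 1)) atTop).mul (hcos φ)
    have hle : (fun n : ℕ => (n : ℝ) ^ m) =O[atTop] fun n : ℕ => (n : ℝ) ^ (m + 1) := by
      refine IsBigO.of_bound 1 ?_
      filter_upwards [eventually_ge_atTop 1] with n hn
      have : (1 : ℝ) ≤ n := by exact_mod_cast hn
      rw [Real.norm_of_nonneg (by positivity), Real.norm_of_nonneg (by positivity), one_mul]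
      exact pow_le_pow_right₀ this (Nat.le_succ m)
    have hnC : (fun n : ℕ => (n : ℝ) * C n) =O[atTop] fun n : ℕ => (n : ℝ) ^ (m + 1) :=
      ((hE.trans hle).add (hP.const_mul_left K)).congr_left fun n => by ring
    have hS : (fun n : ℕ => (((n : ℝ) + 1) ^ (m + 1) - (n : ℝ) ^ (m + 1)) * Real.cos (φ (n + 1)))
        =O[atTop] fun n : ℕ => (n : ℝ) ^ m := by
      simpa using (succ_pow_sub_pow_isBigO m).mul (hcos fun n => φ (n + 1))
    have key := ((((hid.mul hE).sub ((hid.mul hE').const_mul_left (Real.cos θ))).sub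
      ((hid.mul hS).const_mul_left (Real.cos θ * K))).congr_right
        (g₂ := fun n : ℕ => (n : ℝ) ^ (m + 1)) fun n => by ring).add
      (hnC.const_mul_left (2 * ((m : ℝ) + 1)))
    have hD : 2 * ((m : ℝ) + 1) * Real.sin θ ^ 2 ≠ 0 := by positivity
    refine ⟨K * Real.sin θ / (2 * ((m : ℝ) + 1) * Real.sin θ ^ 2), ?_⟩
    refine (key.const_mul_left (2 * ((m : ℝ) + 1) * Real.sin θ ^ 2)⁻¹).congr_left fun n => ?_
    have hg := gegenbauer_add_one ((m : ℝ) + 1) (Real.cos θ) n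
    rw [← Real.sin_sq] at hg
    have e1 : Real.cos (((n : ℝ) + ((m + 1 : ℕ) : ℝ) + 1) * θ
        - (((m + 1 : ℕ) : ℝ) + 1) * (Real.pi / 2)) = Real.sin (φ (n + 1)) := by
      rw [← Real.cos_sub_pi_div_two]
      congr 1
      simp only [hφ]
      push_cast
      ring
    have e2 : Real.cos (φ n) = Real.cos (φ (n + 1)) * Real.cos θ
        + Real.sin (φ (n + 1)) * Real.sin θ := by
      rw [← Real.cos_sub]
      congr 1
      simp only [hφ]
      push_cast
      ring
    rw [e1, e2]
    push_cast
    rw [inv_mul_eq_iff_eq_mul₀ hD]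
    simp only [hC]
    have hdiv := mul_div_cancel₀ (K * Real.sin θ) hD
    linear_combination (-(n : ℝ)) * hg + n * n ^ (m + 1) * Real.sin (φ (n + 1)) * hdiv

/-- A form of Dirichlet's approximation theorem valid for rational and irrational numbers. -/
theorem exists_ge_abs_mul_sub_le_one_div (ξ : ℝ) (N : ℕ) :
    ∃ (q : ℕ) (p : ℤ), N ≤ q ∧ 1 ≤ q ∧ |q * ξ - p| ≤ 1 / q := by
  wlog hN : 1 ≤ N generalizing N
  · obtain ⟨q, p, h1, h⟩ := this 1 le_rfl
    exact ⟨q, p, by omega, h⟩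
  obtain ⟨j, k, hk, hkN, h⟩ := Real.exists_int_int_abs_mul_sub_le ξ (n := N ^ 3) (by positivity)
  lift k to ℕ using hk.le
  push_cast at h
  have hk' : 1 ≤ k := by exact_mod_cast hk
  have hkR : (1 : ℝ) ≤ k := by exact_mod_cast hk'
  have hNR : (1 : ℝ) ≤ N := by exact_mod_cast hN
  by_cases hc : N ≤ k
  · refine ⟨k, j, hc, hk', h.trans ?_⟩
    have : k ≤ N ^ 3 := by exact_mod_cast hkN
    have : (k : ℝ) ≤ N ^ 3 := by exact_mod_cast this
    exact one_div_le_one_div_of_le (by positivity) (by linarith)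
  · refine ⟨N * k, N * j, Nat.le_mul_of_pos_right _ hk', Nat.mul_pos hN hk', ?_⟩
    have hkN' : (k : ℝ) ≤ N := by exact_mod_cast (not_le.mp hc).le
    push_cast
    rw [show (N : ℝ) * k * ξ - N * j = N * (k * ξ - j) by ring, abs_mul, Nat.abs_cast]
    calc (N : ℝ) * |k * ξ - j| ≤ N * (1 / (N ^ 3 + 1)) := by gcongr
      _ ≤ 1 / (N * k) := by
        rw [mul_one_div, div_le_div_iff₀ (by positivity) (by positivity)]
        have : (N : ℝ) * (N * k) ≤ N * (N * N) := by gcongr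
        nlinarith

theorem abs_sin_mul_eq (θ : ℝ) (q : ℝ) (p : ℤ) :
    |Real.sin (q * θ)| = |Real.sin (Real.pi * (q * (θ / Real.pi) - p))| := by
  have hpi := Real.pi_ne_zero
  rw [show Real.pi * (q * (θ / Real.pi) - p) = q * θ - p * Real.pi by field_simp,
    Real.sin_sub_int_mul_pi, abs_mul, abs_zpow, abs_neg, abs_one, one_zpow, one_mul]

theorem abs_cos_sub_odd_mul_pi_div_two (A : ℝ) (k : ℕ) :
    |Real.cos (A - (2 * k + 1) * (Real.pi / 2))| = |Real.sin A| := by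
  rw [show A - (2 * k + 1) * (Real.pi / 2) = A - Real.pi / 2 - k * Real.pi by ring,
    Real.cos_sub_nat_mul_pi, Real.cos_sub_pi_div_two, abs_mul, abs_pow, abs_neg, abs_one, one_pow,
    one_mul]

theorem exists_infinite_abs_gegenbauer_le {lam : ℕ} (hlam : Odd lam) {x : ℝ}
    (hx : x ∈ Set.Ioo (-1 : ℝ) 1) :
    ∃ c : ℝ, 0 ≤ c ∧ {n : ℕ | 1 ≤ n ∧
      |gegenbauer (lam : ℝ) n x| ≤ c * (n : ℝ) ^ ((lam : ℝ) - 2)}.Infinite := by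
  obtain ⟨k, rfl⟩ := hlam
  set θ := Real.arccos x with hθ
  have hcos : Real.cos θ = x := Real.cos_arccos hx.1.le hx.2.le
  have hsin : Real.sin θ ≠ 0 :=
    (Real.sin_pos_of_pos_of_lt_pi (Real.arccos_pos.2 hx.2) (Real.arccos_lt_pi.2 hx.1)).ne'
  obtain ⟨K, hK⟩ := gegenbauer_asymptotics hsin (2 * k)
  obtain ⟨M, hM0, hM⟩ := hK.exists_pos
  obtain ⟨n₀, hn₀⟩ := eventually_atTop.1 hM.bound
  refine ⟨M + |K| * Real.pi, by positivity, ?_⟩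
  rw [Set.infinite_iff_exists_gt]
  intro a
  obtain ⟨q, p, hq, hq1, hqp⟩ :=
    exists_ge_abs_mul_sub_le_one_div (θ / Real.pi) (a + n₀ + 1 + (2 * k + 1))
  obtain ⟨n, rfl⟩ : ∃ n, q = n + (2 * k + 1) := ⟨q - (2 * k + 1), by omega⟩
  have hn1 : 1 ≤ n := by omega
  have hnR : (1 : ℝ) ≤ n := by exact_mod_cast hn1
  have hn0 : (0 : ℝ) < n := by linarith
  refine ⟨n, ⟨hn1, ?_⟩, by omega⟩
  have hb := hn₀ n (by omega)
  have hs : |Real.sin (((n + (2 * k + 1) : ℕ) : ℝ) * θ)| ≤ Real.pi / n := by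
    rw [abs_sin_mul_eq _ _ p]
    refine Real.abs_sin_le_abs.trans ?_
    rw [abs_mul, abs_of_pos Real.pi_pos, div_eq_mul_one_div Real.pi (n : ℝ)]
    gcongr
    refine hqp.trans (one_div_le_one_div_of_le hn0 ?_)
    push_cast
    have : (0 : ℝ) ≤ k := by positivity
    linarith
  have hc := abs_cos_sub_odd_mul_pi_div_two (((n + (2 * k + 1) : ℕ) : ℝ) * θ) k
  push_cast at hb hs hc
  rw [← hc, show (n : ℝ) + (2 * k + 1) = n + 2 * k + 1 by ring] at hs
  rw [hcos] at hb
  rw [Real.norm_eq_abs, Real.norm_eq_abs, abs_mul, abs_of_pos hn0,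
    abs_of_nonneg (a := (n : ℝ) ^ (2 * k)) (by positivity)] at hb
  push_cast
  rw [show (2 * (k : ℝ) + 1 - 2) = ((2 * k : ℕ) : ℝ) - 1 by push_cast; ring,
    Real.rpow_sub_one hn0.ne', Real.rpow_natCast, ← mul_div_assoc, le_div_iff₀ hn0]
  set g := gegenbauer (2 * (k : ℝ) + 1) n x
  set u := Real.cos (((n : ℝ) + 2 * k + 1) * θ - (2 * k + 1) * (Real.pi / 2))
  have hu : (n : ℝ) * |u| ≤ Real.pi := by rwa [le_div_iff₀' hn0] at hs
  have htri : |g| ≤ |g - K * (n : ℝ) ^ (2 * k) * u| + |K| * (n : ℝ) ^ (2 * k) * |u| := by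
    have h := abs_add_le (g - K * (n : ℝ) ^ (2 * k) * u) (K * (n : ℝ) ^ (2 * k) * u)
    rw [sub_add_cancel, abs_mul (K * _), abs_mul K, abs_of_pos (a := (n : ℝ) ^ (2 * k))
      (by positivity)] at h
    exact h
  calc |g| * n ≤ (|g - K * (n : ℝ) ^ (2 * k) * u| + |K| * (n : ℝ) ^ (2 * k) * |u|) * n := by gcongr
    _ = n * |g - K * (n : ℝ) ^ (2 * k) * u| + |K| * (n : ℝ) ^ (2 * k) * (n * |u|) := by ring
    _ ≤ M * (n : ℝ) ^ (2 * k) + |K| * (n : ℝ) ^ (2 * k) * Real.pi :=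
      add_le_add hb (mul_le_mul_of_nonneg_left hu (by positivity))
    _ = _ := by ring

theorem not_isGegenbadlyApproximable {lam : ℕ} (hlam : Odd lam) (x : ℝ) :
    ¬ IsGegenbadlyApproximable (lam : ℝ) x := by
  rintro ⟨hx, c, hc, h⟩
  obtain ⟨c', -, hinf⟩ := exists_infinite_abs_gegenbauer_le hlam hx
  obtain ⟨N, hN⟩ := exists_nat_gt (c' / c)
  obtain ⟨n, ⟨hn1, hn⟩, hNn⟩ := Set.infinite_iff_exists_gt.1 hinf N
  have hn0 : (0 : ℝ) < n := by exact_mod_cast hn1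
  have h1 := (h n hn1).trans hn
  rw [show (lam : ℝ) - 1 = (lam - 2) + 1 by ring, Real.rpow_add_one hn0.ne'] at h1
  have hp : 0 < (n : ℝ) ^ ((lam : ℝ) - 2) := Real.rpow_pos_of_pos hn0 _
  have h2 : c * n ≤ c' := le_of_mul_le_mul_right (by linarith) hp
  rw [div_lt_iff₀' hc] at hN
  have : c * (N : ℝ) < c * n := by gcongr
  linarith

theorem isBadlyApproximable_iff_mul (α : ℝ) :
    IsBadlyApproximable α ↔
      ∃ c : ℝ, 0 < c ∧ ∀ (p : ℤ) (q : ℕ), 1 ≤ q → c / (q : ℝ) ≤ |q * α - p| := by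
  refine exists_congr fun c => and_congr_right fun _ => forall₂_congr fun p q =>
    forall_congr' fun hq => ?_
  have hq0 : (0 : ℝ) < q := by exact_mod_cast hq
  have e : |q * α - p| = q * |α - p / q| := by
    rw [← Nat.abs_cast q, ← abs_mul, Nat.abs_cast]
    congr 1
    field_simp
  rw [e, div_le_iff₀ (by positivity), div_le_iff₀ hq0]
  constructor <;> intro h <;> linarith

/-- Bad approximability of `θ / π` in terms of the sines of the multiples of `θ`. -/
theorem isBadlyApproximable_div_pi_iff (θ : ℝ) :
    IsBadlyApproximable (θ / Real.pi) ↔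
      ∃ c : ℝ, 0 < c ∧ ∀ q : ℕ, 1 ≤ q → c / (q : ℝ) ≤ |Real.sin (q * θ)| := by
  have hpi := Real.pi_pos
  rw [isBadlyApproximable_iff_mul]
  constructor
  · rintro ⟨c, hc, h⟩
    refine ⟨c, hc, fun q hq => (h (round (q * (θ / Real.pi))) q hq).trans ?_⟩
    rw [abs_sin_mul_eq _ _ (round (q * (θ / Real.pi)))]
    set t := q * (θ / Real.pi) - round (q * (θ / Real.pi))
    have ht : |t| ≤ 1 / 2 := abs_sub_round _
    have habs : |Real.pi * t| = Real.pi * |t| := by rw [abs_mul, abs_of_pos hpi]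
    have h2 := Real.mul_abs_le_abs_sin (x := Real.pi * t) (by rw [habs]; nlinarith)
    rw [habs, ← mul_assoc, div_mul_cancel₀ _ hpi.ne'] at h2
    linarith [abs_nonneg t]
  · rintro ⟨c, hc, h⟩
    refine ⟨c / Real.pi, by positivity, fun p q hq => ?_⟩
    have h1 := h q hq
    rw [abs_sin_mul_eq _ _ p] at h1
    have h2 := h1.trans Real.abs_sin_le_abs
    rw [abs_mul, abs_of_pos hpi] at h2
    rwa [div_right_comm, div_le_iff₀' hpi]

theorem div_lt_abs_gegenbauer_one_iff {θ : ℝ} (hθ : Real.sin θ ≠ 0) :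
    (∃ c : ℝ, 0 < c ∧ ∀ n : ℕ, 1 ≤ n → c / (n : ℝ) < |gegenbauer 1 n (Real.cos θ)|) ↔
      IsBadlyApproximable (θ / Real.pi) := by
  have hs : 0 < |Real.sin θ| := abs_pos.2 hθ
  have hg (n : ℕ) : |Real.sin θ| * |gegenbauer 1 n (Real.cos θ)|
      = |Real.sin (((n + 1 : ℕ) : ℝ) * θ)| := by
    rw [← abs_mul, sin_mul_gegenbauer_one]
    push_cast
    rfl
  rw [isBadlyApproximable_div_pi_iff]
  constructor
  · rintro ⟨c, hc, h⟩
    refine ⟨|Real.sin θ| * min c 1, by positivity, fun q hq => ?_⟩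
    obtain ⟨n, rfl⟩ : ∃ n, q = n + 1 := ⟨q - 1, by omega⟩
    rw [← hg, mul_div_assoc]
    gcongr
    rcases Nat.eq_zero_or_pos n with rfl | hn
    · simp [gegenbauer]
    · have hn0 : (0 : ℝ) < n := by exact_mod_cast hn
      refine le_trans ?_ (h n hn).le
      push_cast
      gcongr
      · exact min_le_left _ _
      · linarith
  · rintro ⟨c, hc, h⟩
    refine ⟨c / (4 * |Real.sin θ|), by positivity, fun n hn => ?_⟩
    have hn1 : (1 : ℝ) ≤ n := by exact_mod_cast hn
    have h1 := h (n + 1) (by omega)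
    rw [← hg, ← div_le_iff₀' hs] at h1
    refine lt_of_lt_of_le ?_ h1
    push_cast
    rw [div_div, div_div]
    apply div_lt_div_of_pos_left hc (by positivity)
    nlinarith


theorem theorem1 :
    (∀ lam : ℕ, Odd lam →
      (∀ x : ℝ, ¬ IsGegenbadlyApproximable (lam : ℝ) x) ∧
      (∀ x : ℝ, x ∈ Set.Ioo (-1 : ℝ) 1 → ∃ c : ℝ, 0 ≤ c ∧
        {n : ℕ | 1 ≤ n ∧
          |gegenbauer (lam : ℝ) n x| ≤ c * (n : ℝ) ^ ((lam : ℝ) - 2)}.Infinite)) ∧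
    (∀ x : ℝ, x ∈ Set.Ioo (-1 : ℝ) 1 →
      ((∃ c : ℝ, 0 < c ∧ ∀ n : ℕ, 1 ≤ n → c / (n : ℝ) < |gegenbauer 1 n x|) ↔
        ∃ θ : ℝ, x = Real.cos θ ∧ IsBadlyApproximable (θ / Real.pi))) := by
  refine ⟨fun lam hlam => ⟨not_isGegenbadlyApproximable hlam,
    fun x hx => exists_infinite_abs_gegenbauer_le hlam hx⟩, fun x hx => ?_⟩
  constructor
  · intro h
    have hcos : Real.cos (Real.arccos x) = x := Real.cos_arccos hx.1.le hx.2.le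
    have hsin : Real.sin (Real.arccos x) ≠ 0 :=
      (Real.sin_pos_of_pos_of_lt_pi (Real.arccos_pos.2 hx.2) (Real.arccos_lt_pi.2 hx.1)).ne'
    refine ⟨Real.arccos x, hcos.symm, (div_lt_abs_gegenbauer_one_iff hsin).1 ?_⟩
    rwa [hcos]
  · rintro ⟨θ, rfl, h⟩
    refine (div_lt_abs_gegenbauer_one_iff fun hs => ?_).2 h
    rcases Real.sin_eq_zero_iff_cos_eq.1 hs with h1 | h1 <;> rw [h1] at hx
    · exact lt_irrefl _ hx.2
    · exact lt_irrefl _ hx.1
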